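/- **Notation.** For complex $z\neq0$ let $\log z=\ln|z|+i\arg z$ with $-3\pi/2<\arg z\le\pi/2$; near a point $z_0$ we use the analytic branch of the logarithm that takes this value at $z_0$ (this only matters when $\arg z_0=\pi/2$), and derivatives at $z_0$ are taken of that branch. For integers $\nu\ge0$ put $$R(t,\nu)=\frac{\prod_{j=1}^{\nu}(t-j)}{\prod_{j=0}^{\nu}(t+j)},$$ and for $l\in\{0,1,2\}$, $|z|>1$, put $$f_{l,1}(z,\nu)=\sum_{k=0}^{\nu}(-1)^{(\nu+k)l}z^k\binom{\nu}{k}^{2+l}\binom{\nu+k}{\nu}^{2+l},\qquad f_{l,2}(z,\nu)=\sum_{t=\nu+1}^{\infty}z^{-t}R(t,\nu)^{2+l},$$ $$f_{l,4}=-\sum_{t=\nu+1}^{\infty}z^{-t}\,\partial_t\big(R^{2+l}\big)(t,\nu),\quad f_{l,6}=\tfrac12\sum_{t=\nu+1}^{\infty}z^{-t}\,\partial_t^2\big(R^{2+l}\big)(t,\nu),\quad f_{l,8}=-\tfrac16\sum_{t=\nu+1}^{\infty}z^{-t}\,\partial_t^3\big(R^{2+l}\big)(t,\nu),$$ $$f_{l,3}=(\log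 z)f_{l,2}+f_{l,4},\qquad f_{l,5}=\tfrac12(\log z)^2f_{l,2}+(\log z)f_{l,4}+f_{l,6},$$ $$f_{l,7}=\tfrac16(\log z)^3f_{l,2}-\tfrac12(\log z)^2f_{l,3}+(\log z)f_{l,5}+f_{l,8}.$$ Put $f^\vee_{l,k}=f_{l,k}$ for $k=1,2,3$, $f^\vee_{l,5}=-i\pi f_{l,3}+f_{l,5}$, $f^\vee_{l,7}=f_{l,7}+\tfrac{2\pi^2}{3}f_{l,3}$, and let $\mathfrak K_0=\{1,2,3\}$, $\mathfrak K_1=\{1,2,3,5\}$, $\mathfrak K_2=\{1,2,3,5,7\}$. Let $\delta=z\frac{d}{dz}$, and for $k\in\mathfrak K_l$ and $\nu\ge1$ let $Y_{l,k}(z;\nu)$ be the column with $4+2l$ entries whose $i$-th entry is $(\nu^{-1}\delta)^{i-1}f^\vee_{l,k}(z,\nu)$, $1\le i\le4+2l$. Let $T_{n,\lambda}$ be the diagonal $n\times n$ matrix with entries $1,\lambda,\dots,\lambda^{n-1}$, and write $T_l=T_{4+2l,-1}$. For complex $z$ and $\nu\ne0$ let $$A_l^\sim(z;\nu)=S_l^\sim+z\sum_{i=0}^{1+l}\nu^{-i}V_l^{\sim*}(i),$$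 where $$S_0^\sim=\begin{pmatrix}1&-4&8&-12\\0&1&-4&8\\0&0&1&-4\\0&0&0&1\end{pmatrix},$$ $$S_1^\sim=\begin{pmatrix}-1&6&-18&38&-66&102\\0&-1&6&-18&38&-66\\0&0&-1&6&-18&38\\0&0&0&-1&6&-18\\0&0&0&0&-1&6\\0&0&0&0&0&-1\end{pmatrix},$$ $$S_2^\sim=\begin{pmatrix}1&-8&32&-88&192&-360&608&-952\\0&1&-8&32&-88&192&-360&608\\0&0&1&-8&32&-88&192&-360\\0&0&0&1&-8&32&-88&192\\0&0&0&0&1&-8&32&-88\\0&0&0&0&0&1&-8&32\\0&0&0&0&0&0&1&-8\\0&0&0&0&0&0&0&1\end{pmatrix},$$ $$V_0^{\sim*}(0)=4\begin{pmatrix}4&-5&-2&3\\-3&4&1&-2\\2&-3&0&1\\-1&2&-1&0\end{pmatrix},$$ $$V_0^{\sim*}(1)=4\begin{pmatrix}3&-6&3&0\\-2&4&-2&0\\1&-2&1&0\\0&0&0&0\end{pmatrix},$$ $$V_1^{\sim*}(0)=\begin{pmatrix}146&-198&-180&268&66&-102\\-102&146&108&-180&-38&66\\66&-102&-52&108&18&-38\\-38&66&12&-52&-6&18\\18&-38&12&12&2&-6\\-6&18&-20&12&-6&2\end{pmatrix},$$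 $$V_1^{\sim*}(1)=\begin{pmatrix}240&-516&108&372&-204&0\\-160&348&-84&-236&132&0\\96&-212&60&132&-76&0\\-48&108&-36&-60&36&0\\16&-36&12&20&-12&0\\0&-4&12&-12&4&0\end{pmatrix},$$ $$V_1^{\sim*}(2)=\begin{pmatrix}102&-306&306&-102&0&0\\-66&198&-198&66&0&0\\38&-114&114&-38&0&0\\-18&54&-54&18&0&0\\6&-18&18&-6&0&0\\-2&6&-6&2&0&0\end{pmatrix},$$ $$V_2^{\sim*}(0)=8\begin{pmatrix}176&-249&-364&545&280&-431&-76&119\\-119&176&227&-364&-169&280&45&-76\\76&-119&-128&227&92&-169&-24&45\\-45&76&61&-128&-43&92&11&-24\\24&-45&-20&61&16&-43&-4&11\\-11&24&-1&-20&-5&16&1&-4\\4&-11&8&-1&4&-5&0&1\\-1&4&-7&8&-7&4&-1&0\end{pmatrix},$$ $$V_2^{\sim*}(1)=8\begin{pmatrix}455&-1020&-113&1552&-603&-628&357&0\\-300&682&44&-996&404&394&-228&0\\185&-428&-3&592&-253&-228&135&0\\-104&246&-16&-316&144&118&-72&0\\51&-124&19&144&-71&-52&33&0\\-20&50&-12&-52&28&18&-12&0\\5&-12&1&16&-9&-4&3&0\\0&-2&8&-12&8&-2&0&0\end{pmatrix},$$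 $$V_2^{\sim*}(2)=8\begin{pmatrix}400&-1243&972&542&-1028&357&0&0\\-259&808&-642&-332&653&-228&0&0\\156&-489&396&186&-384&135&0&0\\-85&268&-222&-92&203&-72&0&0\\40&-127&108&38&-92&33&0&0\\-15&48&-42&-12&33&-12&0&0\\4&-13&12&2&-8&3&0&0\\-1&4&-6&4&-1&0&0&0\end{pmatrix},$$ $$V_2^{\sim*}(3)=8\begin{pmatrix}119&-476&714&-476&119&0&0&0\\-76&304&-456&304&-76&0&0&0\\45&-180&270&-180&45&0&0&0\\-24&96&-144&96&-24&0&0&0\\11&-44&66&-44&11&0&0&0\\-4&16&-24&16&-4&0&0&0\\1&-4&6&-4&1&0&0&0\\0&0&0&0&0&0&0&0\end{pmatrix}.$$ **Theorem 1.** (a) For all $l\in\{0,1,2\}$, $k\in\mathfrak K_l$, $z\in\mathbb C$ with $|z|>1$, and integers $\nu\ge2$, $$A_l^\sim(z;\nu)\,Y_{l,k}(z;\nu)=T_{4+2l,\,1-\nu^{-1}}\,Y_{l,k}(z;\nu-1),$$ $$Y_{l,k}(z;\nu)=T_{4+2l,-1}\,A_l^\sim(z;-\nu)\,T_{4+2l,\,-1+\nu^{-1}}\,Y_{l,k}(z;\nu-1).$$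 (b) For all $l\in\{0,1,2\}$ and $i,k\in\{0,\dots,1+l\}$, and all complex $z$ and $\nu\ne0$, $$A_l^\sim(z;-\nu)\,T_l\,A_l^\sim(z;\nu)=T_l,$$ the matrix $S_l^\sim T_l$ is invertible and $$S_l^\sim T_l=(S_l^\sim T_l)^{-1},$$ $$S_l^\sim T_l\,V_l^{\sim*}(i)=-(-1)^i\,V_l^{\sim*}(i)\,T_l\,S_l^\sim,$$ $$V_l^{\sim*}(i)\,T_l\,V_l^{\sim*}(k)=0.$$ -/

import Mathlib

open scoped Real

/-! ### The functions -/

/-- `R(t, ν) = ∏_{j=1}^{ν} (t - j) / ∏_{j=0}^{ν} (t + j)`. -/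
noncomputable def ratR (t : ℂ) (ν : ℕ) : ℂ :=
  (∏ j ∈ Finset.Icc 1 ν, (t - (j : ℂ))) / ∏ j ∈ Finset.range (ν + 1), (t + (j : ℂ))

/-- The argument of `z`, normalised by `-3π/2 < arg z ≤ π/2`. -/
noncomputable def argC (z : ℂ) : ℝ :=
  if z.arg ≤ π / 2 then z.arg else z.arg - 2 * π

/-- The logarithm belonging to the choice `-3π/2 < arg z ≤ π/2`. -/
noncomputable def logC (z : ℂ) : ℂ :=
  (Real.log ‖z‖ : ℂ) + Complex.I * (argC z : ℂ)

/-- `L` is, near `z`, the analytic branch of the logarithm with the prescribed value at `z`.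
Away from the half-line `arg z = π / 2`, on which `logC` jumps, `logC` itself is such an `L`. -/
def IsLogNear (L : ℂ → ℂ) (z : ℂ) : Prop :=
  AnalyticAt ℂ L z ∧ (∀ᶠ w in nhds z, Complex.exp (L w) = w) ∧ L z = logC z

theorem exp_logC {z : ℂ} (hz : z ≠ 0) : Complex.exp (logC z) = z := by
  have h : Complex.exp (Complex.I * (argC z : ℂ)) = Complex.exp (z.arg * Complex.I) := by
    unfold argC
    split_ifs
    · rw [mul_comm]
    · rw [Complex.exp_eq_exp_iff_exists_int]
      refine ⟨-1, ?_⟩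
      push_cast
      ring
  rw [logC, Complex.exp_add, h, ← Complex.ofReal_exp, Real.exp_log (norm_pos_iff.mpr hz),
    Complex.norm_mul_exp_arg_mul_I]

/-- Such a branch exists at every nonzero point. -/
theorem exists_isLogNear {z : ℂ} (hz : z ≠ 0) : ∃ L, IsLogNear L z := by
  refine ⟨fun w => logC z + Complex.log (w / z), ?_, ?_, ?_⟩
  · refine analyticAt_const.add ((analyticAt_id.div analyticAt_const hz).clog ?_)
    change z / z ∈ Complex.slitPlane
    rw [div_self hz]
    exact Complex.one_mem_slitPlane
  · filter_upwards [isOpen_ne.mem_nhds hz] with w hw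
    rw [Complex.exp_add, exp_logC hz, Complex.exp_log (div_ne_zero hw hz),
      mul_div_cancel₀ _ hz]
  · simp [hz]

/-- Away from the half-line `arg z = π / 2` the normalised logarithm is such a branch. -/
theorem isLogNear_logC {z : ℂ} (hz : z ≠ 0) (hcut : ¬ (z.re = 0 ∧ 0 < z.im)) :
    IsLogNear logC z := by
  have key : ∀ w : ℂ, w ≠ 0 →
      logC w = Complex.log (Complex.I * w) - (π / 2 : ℝ) * Complex.I := by
    intro w hw
    have hI : Complex.I * w ≠ 0 := mul_ne_zero Complex.I_ne_zero hw
    have hpi := Real.pi_pos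
    have h1 := Complex.neg_pi_lt_arg w
    have h2 := Complex.arg_le_pi w
    have hb : -(3 * π / 2) < argC w ∧ argC w ≤ π / 2 := by
      unfold argC
      split_ifs <;> constructor <;> linarith
    have he : Complex.exp (logC w + (π / 2 : ℝ) * Complex.I) = Complex.I * w := by
      rw [Complex.exp_add, exp_logC hw]
      push_cast
      rw [Complex.exp_pi_div_two_mul_I, mul_comm]
    have him : (logC w + (π / 2 : ℝ) * Complex.I).im = argC w + π / 2 := by
      simp [logC]
    rw [← he, Complex.log_exp (by rw [him]; linarith [hb.1]) (by rw [him]; linarith [hb.2])]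
    ring
  have hev : (fun w : ℂ => Complex.log (Complex.I * w) - (π / 2 : ℝ) * Complex.I) =ᶠ[nhds z]
      logC := by
    filter_upwards [isOpen_ne.mem_nhds hz] with w hw using (key w hw).symm
  refine ⟨AnalyticAt.congr ?_ hev, ?_, rfl⟩
  · refine AnalyticAt.sub ((analyticAt_const.mul analyticAt_id).clog ?_) analyticAt_const
    change Complex.I * z ∈ Complex.slitPlane
    rw [Complex.mem_slitPlane_iff, Complex.I_mul_re, Complex.I_mul_im]
    by_contra! h
    refine hcut ⟨h.2, lt_of_le_of_ne (by linarith [h.1]) fun h0 => hz ?_⟩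
    exact Complex.ext h.2 h0.symm
  · filter_upwards [isOpen_ne.mem_nhds hz] with w hw using exp_logC hw

/-- `f_{l,1}(z, ν)` -/
noncomputable def f1 (l : ℕ) (z : ℂ) (ν : ℕ) : ℂ :=
  ∑ k ∈ Finset.range (ν + 1), (-1) ^ ((ν + k) * l) * z ^ k *
    (ν.choose k : ℂ) ^ (2 + l) * ((ν + k).choose ν : ℂ) ^ (2 + l)

/-- `∑_{t = ν + 1}^∞ z^{-t} ((∂/∂t)^j R^{2 + l})(t, ν)` -/
noncomputable def serR (l j : ℕ) (z : ℂ) (ν : ℕ) : ℂ :=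
  ∑' m : ℕ, (z ^ (ν + 1 + m))⁻¹ *
    iteratedDeriv j (fun t : ℂ => ratR t ν ^ (2 + l)) ((ν + 1 + m : ℕ) : ℂ)

/-- `f_{l,2}(z, ν)` -/
noncomputable def f2 (l : ℕ) (z : ℂ) (ν : ℕ) : ℂ := serR l 0 z ν

/-- `f_{l,4}(z, ν)` -/
noncomputable def f4 (l : ℕ) (z : ℂ) (ν : ℕ) : ℂ := -serR l 1 z ν

/-- `f_{l,6}(z, ν)` -/
noncomputable def f6 (l : ℕ) (z : ℂ) (ν : ℕ) : ℂ := 2⁻¹ * serR l 2 z ν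

/-- `f_{l,8}(z, ν)` -/
noncomputable def f8 (l : ℕ) (z : ℂ) (ν : ℕ) : ℂ := -6⁻¹ * serR l 3 z ν

/-- `f_{l,3}(z, ν)`, formed with the logarithm `L` -/
noncomputable def f3 (L : ℂ → ℂ) (l : ℕ) (z : ℂ) (ν : ℕ) : ℂ :=
  L z * f2 l z ν + f4 l z ν

/-- `f_{l,5}(z, ν)`, formed with the logarithm `L` -/
noncomputable def f5 (L : ℂ → ℂ) (l : ℕ) (z : ℂ) (ν : ℕ) : ℂ :=
  2⁻¹ * L z ^ 2 * f2 l z ν + L z * f4 l z ν + f6 l z ν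

/-- `f_{l,7}(z, ν)`, formed with the logarithm `L` -/
noncomputable def f7 (L : ℂ → ℂ) (l : ℕ) (z : ℂ) (ν : ℕ) : ℂ :=
  6⁻¹ * L z ^ 3 * f2 l z ν - 2⁻¹ * L z ^ 2 * f3 L l z ν + L z * f5 L l z ν + f8 l z ν

/-- The index sets `𝔎_0 = {1, 2, 3}`, `𝔎_1 = {1, 2, 3, 5}`, `𝔎_2 = {1, 2, 3, 5, 7}`. -/
def setK : Fin 3 → Finset ℕ
  | 0 => {1, 2, 3}
  | 1 => {1, 2, 3, 5}
  | 2 => {1, 2, 3, 5, 7}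

/-- `f^∨_{l,k}(z, ν)`, formed with the logarithm `L`; used only for `k` in `setK l`. -/
noncomputable def fCheck (L : ℂ → ℂ) (l : ℕ) : ℕ → ℂ → ℕ → ℂ
  | 1, z, ν => f1 l z ν
  | 2, z, ν => f2 l z ν
  | 3, z, ν => f3 L l z ν
  | 5, z, ν => -Complex.I * π * f3 L l z ν + f5 L l z ν
  | 7, z, ν => f7 L l z ν + (2 * π ^ 2 / 3) * f3 L l z ν
  | _, _, _ => 0

/-- The operator `ν⁻¹ δ`, where `δ = z d/dz`. -/
noncomputable def deltaOp (ν : ℕ) (g : ℂ → ℂ) : ℂ → ℂ :=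
  fun z => (ν : ℂ)⁻¹ * (z * deriv g z)

/-- The column `Y_{l,k}(z; ν)` (rows numbered from `0`). -/
noncomputable def colY (L : ℂ → ℂ) (l k : ℕ) (z : ℂ) (ν : ℕ) : Fin (4 + 2 * l) → ℂ :=
  fun i => (deltaOp ν)^[(i : ℕ)] (fun w => fCheck L l k w ν) z

/-! ### The matrices -/

/-- `T_{n,x}`, the diagonal matrix with entries `1, x, …, x ^ (n - 1)`. -/
def matT {A : Type*} [CommRing A] (n : ℕ) (x : A) : Matrix (Fin n) (Fin n) A :=
  Matrix.diagonal fun i => x ^ (i : ℕ)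

/-- `S^∼_0` -/
def matS0 : Matrix (Fin 4) (Fin 4) ℤ :=
  !![1, -4, 8, -12;
     0, 1, -4, 8;
     0, 0, 1, -4;
     0, 0, 0, 1]

/-- `V^{∼*}_0(0)` -/
def matV0_0 : Matrix (Fin 4) (Fin 4) ℤ :=
  (4 : ℤ) • !![4, -5, -2, 3;
     -3, 4, 1, -2;
     2, -3, 0, 1;
     -1, 2, -1, 0]

/-- `V^{∼*}_0(1)` -/
def matV0_1 : Matrix (Fin 4) (Fin 4) ℤ :=
  (4 : ℤ) • !![3, -6, 3, 0;
     -2, 4, -2, 0;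
     1, -2, 1, 0;
     0, 0, 0, 0]

/-- `S^∼_1` -/
def matS1 : Matrix (Fin 6) (Fin 6) ℤ :=
  !![-1, 6, -18, 38, -66, 102;
     0, -1, 6, -18, 38, -66;
     0, 0, -1, 6, -18, 38;
     0, 0, 0, -1, 6, -18;
     0, 0, 0, 0, -1, 6;
     0, 0, 0, 0, 0, -1]

/-- `V^{∼*}_1(0)` -/
def matV1_0 : Matrix (Fin 6) (Fin 6) ℤ :=
  !![146, -198, -180, 268, 66, -102;
     -102, 146, 108, -180, -38, 66;
     66, -102, -52, 108, 18, -38;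
     -38, 66, 12, -52, -6, 18;
     18, -38, 12, 12, 2, -6;
     -6, 18, -20, 12, -6, 2]

/-- `V^{∼*}_1(1)` -/
def matV1_1 : Matrix (Fin 6) (Fin 6) ℤ :=
  !![240, -516, 108, 372, -204, 0;
     -160, 348, -84, -236, 132, 0;
     96, -212, 60, 132, -76, 0;
     -48, 108, -36, -60, 36, 0;
     16, -36, 12, 20, -12, 0;
     0, -4, 12, -12, 4, 0]

/-- `V^{∼*}_1(2)` -/
def matV1_2 : Matrix (Fin 6) (Fin 6) ℤ :=
  !![102, -306, 306, -102, 0, 0;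
     -66, 198, -198, 66, 0, 0;
     38, -114, 114, -38, 0, 0;
     -18, 54, -54, 18, 0, 0;
     6, -18, 18, -6, 0, 0;
     -2, 6, -6, 2, 0, 0]

/-- `S^∼_2` -/
def matS2 : Matrix (Fin 8) (Fin 8) ℤ :=
  !![1, -8, 32, -88, 192, -360, 608, -952;
     0, 1, -8, 32, -88, 192, -360, 608;
     0, 0, 1, -8, 32, -88, 192, -360;
     0, 0, 0, 1, -8, 32, -88, 192;
     0, 0, 0, 0, 1, -8, 32, -88;
     0, 0, 0, 0, 0, 1, -8, 32;
     0, 0, 0, 0, 0, 0, 1, -8;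
     0, 0, 0, 0, 0, 0, 0, 1]

/-- `V^{∼*}_2(0)` -/
def matV2_0 : Matrix (Fin 8) (Fin 8) ℤ :=
  (8 : ℤ) • !![176, -249, -364, 545, 280, -431, -76, 119;
     -119, 176, 227, -364, -169, 280, 45, -76;
     76, -119, -128, 227, 92, -169, -24, 45;
     -45, 76, 61, -128, -43, 92, 11, -24;
     24, -45, -20, 61, 16, -43, -4, 11;
     -11, 24, -1, -20, -5, 16, 1, -4;
     4, -11, 8, -1, 4, -5, 0, 1;
     -1, 4, -7, 8, -7, 4, -1, 0]

/-- `V^{∼*}_2(1)` -/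
def matV2_1 : Matrix (Fin 8) (Fin 8) ℤ :=
  (8 : ℤ) • !![455, -1020, -113, 1552, -603, -628, 357, 0;
     -300, 682, 44, -996, 404, 394, -228, 0;
     185, -428, -3, 592, -253, -228, 135, 0;
     -104, 246, -16, -316, 144, 118, -72, 0;
     51, -124, 19, 144, -71, -52, 33, 0;
     -20, 50, -12, -52, 28, 18, -12, 0;
     5, -12, 1, 16, -9, -4, 3, 0;
     0, -2, 8, -12, 8, -2, 0, 0]

/-- `V^{∼*}_2(2)` -/
def matV2_2 : Matrix (Fin 8) (Fin 8) ℤ :=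
  (8 : ℤ) • !![400, -1243, 972, 542, -1028, 357, 0, 0;
     -259, 808, -642, -332, 653, -228, 0, 0;
     156, -489, 396, 186, -384, 135, 0, 0;
     -85, 268, -222, -92, 203, -72, 0, 0;
     40, -127, 108, 38, -92, 33, 0, 0;
     -15, 48, -42, -12, 33, -12, 0, 0;
     4, -13, 12, 2, -8, 3, 0, 0;
     -1, 4, -6, 4, -1, 0, 0, 0]

/-- `V^{∼*}_2(3)` -/
def matV2_3 : Matrix (Fin 8) (Fin 8) ℤ :=
  (8 : ℤ) • !![119, -476, 714, -476, 119, 0, 0, 0;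
     -76, 304, -456, 304, -76, 0, 0, 0;
     45, -180, 270, -180, 45, 0, 0, 0;
     -24, 96, -144, 96, -24, 0, 0, 0;
     11, -44, 66, -44, 11, 0, 0, 0;
     -4, 16, -24, 16, -4, 0, 0, 0;
     1, -4, 6, -4, 1, 0, 0, 0;
     0, 0, 0, 0, 0, 0, 0, 0]

/-- `S^∼_l` -/
def matS : (l : Fin 3) →
    Matrix (Fin (4 + 2 * (l : ℕ))) (Fin (4 + 2 * (l : ℕ))) ℤ
  | 0 => matS0
  | 1 => matS1
  | 2 => matS2

/-- `V^{∼*}_l(i)`, used only for `0 ≤ i ≤ 1 + l` -/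
def matV : (l : Fin 3) → ℕ →
    Matrix (Fin (4 + 2 * (l : ℕ))) (Fin (4 + 2 * (l : ℕ))) ℤ
  | 0, 0 => matV0_0
  | 0, 1 => matV0_1
  | 1, 0 => matV1_0
  | 1, 1 => matV1_1
  | 1, 2 => matV1_2
  | 2, 0 => matV2_0
  | 2, 1 => matV2_1
  | 2, 2 => matV2_2
  | 2, 3 => matV2_3
  | _, _ => 0

/-- `A^∼_l(z; ν) = S^∼_l + z ∑_{i=0}^{1+l} ν^{-i} V^{∼*}_l(i)` for complex `z` and `ν ≠ 0` -/
noncomputable def matA (l : Fin 3) (z ν : ℂ) :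
    Matrix (Fin (4 + 2 * (l : ℕ))) (Fin (4 + 2 * (l : ℕ))) ℂ :=
  (matS l).map (Int.cast : ℤ → ℂ) +
    z • ∑ i ∈ Finset.range (2 + (l : ℕ)), (ν ^ i)⁻¹ • (matV l i).map (Int.cast : ℤ → ℂ)

/-! Write m = 2 + l and Q = R(s, ν-1) / ((s+ν)(s+ν+1)). Then R(s, ν) = Q (s-ν)(s+ν+1), R(s+1, ν) = Q
s² and R(s, ν-1) = Q (s+ν)(s+ν+1). Row i of the recursion is therefore, after division by Q^m, a
polynomial identity in s and ν: the S-row at -s against R(s, ν)^m, plus the V-row at -(s+1) against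
R(s+1, ν)^m, gives (-s/ν)^i R(s, ν-1)^m (`row_identity_scaled`).

Multiply by z^{-s}, differentiate j times in s and sum over s = 1, 2, …. The operator δ acts as -s,
and the factor z in A shifts s to s+1; the boundary term at s = 1 vanishes because R(·, ν)^m has a
zero of order m > j there. Up to a factor these sums are f_2, f_3, f_5, f_7 for j = 0, 1, 2, 3, with
z^{-s} = exp(-s log z) (`isSolution_logSum`). For f_1 the same identity is used at s = -k, with
residues in place of values of R (`isSolution_residueSum`).

Part (b) is a finite computation with integer matrices, followed by an expansion of A(-ν) T A(ν).
This identity inverts A(ν), which turns the first recursion of (a) into the second. -/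

/-! ### Integer matrix identities and the inversion of A. -/

theorem matS_mul_matT_mul_matS (l : Fin 3) :
    matS l * matT (4 + 2 * (l : ℕ)) (-1 : ℤ) * matS l = matT (4 + 2 * (l : ℕ)) (-1 : ℤ) := by
  revert l
  decide +kernel

theorem matS_mul_matT_mul_matV (l : Fin 3) (i : ℕ) (hi : i ≤ 1 + (l : ℕ)) :
    matS l * matT (4 + 2 * (l : ℕ)) (-1 : ℤ) * matV l i =
      (-(-1 : ℤ) ^ i) • (matV l i * matT (4 + 2 * (l : ℕ)) (-1 : ℤ) * matS l) := by
  have h : ∀ l : Fin 3, ∀ i ∈ Finset.range (2 + (l : ℕ)),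
      matS l * matT (4 + 2 * (l : ℕ)) (-1 : ℤ) * matV l i =
      (-(-1 : ℤ) ^ i) • (matV l i * matT (4 + 2 * (l : ℕ)) (-1 : ℤ) * matS l) := by
    decide +kernel
  exact h l i (Finset.mem_range.2 (by lia))

theorem matV_mul_matT_mul_matV (l : Fin 3) (i k : ℕ) (hi : i ≤ 1 + (l : ℕ))
    (hk : k ≤ 1 + (l : ℕ)) :
    matV l i * matT (4 + 2 * (l : ℕ)) (-1 : ℤ) * matV l k = 0 := by
  have h : ∀ l : Fin 3, ∀ i ∈ Finset.range (2 + (l : ℕ)), ∀ k ∈ Finset.range (2 + (l : ℕ)),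
      matV l i * matT (4 + 2 * (l : ℕ)) (-1 : ℤ) * matV l k = 0 := by
    decide +kernel
  exact h l i (Finset.mem_range.2 (by lia)) k (Finset.mem_range.2 (by lia))

theorem matT_mul_matT {A : Type*} [CommRing A] (n : ℕ) (x y : A) :
    matT n x * matT n y = matT n (x * y) := by
  simp [matT, Matrix.diagonal_mul_diagonal, mul_pow]

theorem matT_one {A : Type*} [CommRing A] (n : ℕ) : matT n (1 : A) = 1 := by
  simp [matT]

theorem matT_map (n : ℕ) (x : ℤ) :
    (matT n x).map (Int.cast : ℤ → ℂ) = matT n (x : ℂ) := by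
  ext i j
  by_cases h : i = j <;> simp [matT, Matrix.diagonal, h]

/-- In powers of z: the constant term is S T S = T, the linear terms cancel since (-ν)^{-i} = (-1)^i
ν^{-i} meets the sign -(-1)^i of the commutation rule, and the quadratic term vanishes because every
V(i) T V(k) does. -/
theorem matA_mul_matT_mul_matA (l : Fin 3) (z ν : ℂ) :
    matA l z (-ν) * matT (4 + 2 * (l : ℕ)) (-1 : ℂ) * matA l z ν =
      matT (4 + 2 * (l : ℕ)) (-1 : ℂ) := by
  set n := 4 + 2 * (l : ℕ)
  let φ : Matrix (Fin n) (Fin n) ℤ →+* Matrix (Fin n) (Fin n) ℂ := (Int.castRingHom ℂ).mapMatrix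
  have hφ : ∀ M, φ M = M.map (Int.cast : ℤ → ℂ) := fun M => rfl
  have hT : φ (matT n (-1)) = matT n (-1 : ℂ) := by
    rw [hφ, matT_map]; simp
  set T := matT n (-1 : ℂ)
  set S := φ (matS l) with hS
  have hSS : S * T * S = T := by
    rw [← hT, hS, ← map_mul, ← map_mul, matS_mul_matT_mul_matS]
  have hSV : ∀ i ∈ Finset.range (2 + (l : ℕ)),
      S * T * φ (matV l i) = (-(-1 : ℂ) ^ i) • (φ (matV l i) * T * S) := by
    intro i hi
    rw [← hT, hS, ← map_mul, ← map_mul,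
      matS_mul_matT_mul_matV l i (by have := Finset.mem_range.1 hi; lia), ← map_mul, ← map_mul]
    rcases Nat.even_or_odd i with h | h <;> ext a b <;> simp [hφ, h.neg_one_pow, n]
  have hVV : ∀ i ∈ Finset.range (2 + (l : ℕ)), ∀ k ∈ Finset.range (2 + (l : ℕ)),
      φ (matV l i) * T * φ (matV l k) = 0 := by
    intro i hi k hk
    rw [← hT, ← map_mul, ← map_mul, matV_mul_matT_mul_matV l i k
      (by have := Finset.mem_range.1 hi; lia) (by have := Finset.mem_range.1 hk; lia), map_zero]
  have hA : ∀ ν, matA l z ν = S + z • ∑ i ∈ Finset.range (2 + (l : ℕ)),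
    (ν ^ i)⁻¹ • φ (matV l i) := fun ν => rfl
  rw [hA, hA, add_mul, add_mul, mul_add, mul_add, hSS]
  have h1 : S * T * (z • ∑ i ∈ Finset.range (2 + (l : ℕ)), (ν ^ i)⁻¹ • φ (matV l i)) +
      (z • ∑ i ∈ Finset.range (2 + (l : ℕ)), ((-ν) ^ i)⁻¹ • φ (matV l i)) * T * S = 0 := by
    rw [Matrix.mul_smul, Matrix.smul_mul, Matrix.smul_mul, ← smul_add, Finset.mul_sum,
      Finset.sum_mul, Finset.sum_mul, ← Finset.sum_add_distrib, Finset.sum_eq_zero, smul_zero]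
    intro i hi
    rw [Matrix.mul_smul, Matrix.smul_mul, Matrix.smul_mul, hSV i hi, smul_smul, ← add_smul]
    have : (ν ^ i)⁻¹ * -(-1) ^ i + ((-ν) ^ i)⁻¹ = (0 : ℂ) := by
      rw [neg_pow ν, mul_inv]
      rcases neg_one_pow_eq_or ℂ i with h | h <;> simp [h]
    rw [this, zero_smul]
  have h2 : (z • ∑ i ∈ Finset.range (2 + (l : ℕ)), ((-ν) ^ i)⁻¹ • φ (matV l i)) * T *
      (z • ∑ i ∈ Finset.range (2 + (l : ℕ)), (ν ^ i)⁻¹ • φ (matV l i)) = 0 := by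
    rw [Matrix.mul_smul, Matrix.smul_mul, Matrix.smul_mul, Finset.sum_mul, Finset.sum_mul,
      Finset.sum_eq_zero, smul_zero, smul_zero]
    intro i hi
    rw [Finset.mul_sum, Finset.sum_eq_zero]
    intro k hk
    rw [Matrix.mul_smul, Matrix.smul_mul, Matrix.smul_mul, hVV i hi k hk, smul_zero, smul_zero]
  rw [h2, add_zero, add_assoc, h1, add_zero]

/-! ### The polynomial identity for the rows. -/

/-- The polynomial identity behind the rows of `A^∼_0(z; ν)`, with `x = s / ν` and
`y = ν⁻¹`. -/
theorem row_identity_zero (x y : ℂ) (i : Fin 4) :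
    (∑ p : Fin 4, (matS 0 i p : ℂ) * (-x) ^ (p : ℕ)) * ((x - 1) * (x + 1 + y)) ^ 2 +
      (∑ p : Fin 4, (∑ a ∈ Finset.range 2, y ^ a * (matV 0 a i p : ℂ)) *
        (-(x + y)) ^ (p : ℕ)) * (x ^ 2) ^ 2 =
      (-x) ^ (i : ℕ) * ((x + 1) * (x + 1 + y)) ^ 2 := by
  fin_cases i <;>
  simp [matS, matV, matS0, matV0_0, matV0_1, Finset.sum_range_succ, Fin.sum_univ_succ] <;> ring

theorem row_identity_one (x y : ℂ) (i : Fin 6) :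
    (∑ p : Fin 6, (matS 1 i p : ℂ) * (-x) ^ (p : ℕ)) * ((x - 1) * (x + 1 + y)) ^ 3 +
      (∑ p : Fin 6, (∑ a ∈ Finset.range 3, y ^ a * (matV 1 a i p : ℂ)) *
        (-(x + y)) ^ (p : ℕ)) * (x ^ 2) ^ 3 =
      (-x) ^ (i : ℕ) * ((x + 1) * (x + 1 + y)) ^ 3 := by
  fin_cases i <;>
  simp [matS, matV, matS1, matV1_0, matV1_1, matV1_2, Finset.sum_range_succ,
    Fin.sum_univ_succ] <;> ring

theorem row_identity_two (x y : ℂ) (i : Fin 8) :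
    (∑ p : Fin 8, (matS 2 i p : ℂ) * (-x) ^ (p : ℕ)) * ((x - 1) * (x + 1 + y)) ^ 4 +
      (∑ p : Fin 8, (∑ a ∈ Finset.range 4, y ^ a * (matV 2 a i p : ℂ)) *
        (-(x + y)) ^ (p : ℕ)) * (x ^ 2) ^ 4 =
      (-x) ^ (i : ℕ) * ((x + 1) * (x + 1 + y)) ^ 4 := by
  fin_cases i <;>
  simp [matS, matV, matS2, matV2_0, matV2_1, matV2_2, matV2_3, Finset.sum_range_succ,
    Fin.sum_univ_succ] <;> ring

/-- The `(i, p)` entry of `∑ a, ν⁻ᵃ V_l(a)`. -/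
noncomputable def shiftEntry (l : Fin 3) (ν : ℂ) (i p : Fin (4 + 2 * (l : ℕ))) : ℂ :=
  ∑ a ∈ Finset.range (2 + (l : ℕ)), (ν ^ a)⁻¹ * (matV l a i p : ℂ)

theorem matA_apply (l : Fin 3) (z ν : ℂ) (i p : Fin (4 + 2 * (l : ℕ))) :
    matA l z ν i p = (matS l i p : ℂ) + z * shiftEntry l ν i p := by
  simp [matA, shiftEntry, Matrix.sum_apply]

theorem row_identity (l : Fin 3) (x y : ℂ) (i : Fin (4 + 2 * (l : ℕ))) :
    (∑ p, (matS l i p : ℂ) * (-x) ^ (p : ℕ)) * ((x - 1) * (x + 1 + y)) ^ (2 + (l : ℕ)) +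
      (∑ p, (∑ a ∈ Finset.range (2 + (l : ℕ)), y ^ a * (matV l a i p : ℂ)) *
        (-(x + y)) ^ (p : ℕ)) * (x ^ 2) ^ (2 + (l : ℕ)) =
      (-x) ^ (i : ℕ) * ((x + 1) * (x + 1 + y)) ^ (2 + (l : ℕ)) := by
  fin_cases l
  · exact row_identity_zero x y i
  · exact row_identity_one x y i
  · exact row_identity_two x y i

/-- The three factors raised to the power 2 + l are homogeneous quadratics in s, ν and 1, so setting
x = s/ν, y = 1/ν costs exactly (ν²)^(2+l). -/
theorem row_identity_scaled (l : Fin 3) (s : ℂ) {ν : ℂ} (hν : ν ≠ 0)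
    (i : Fin (4 + 2 * (l : ℕ))) :
    (∑ p, (matS l i p : ℂ) * (ν⁻¹ ^ (p : ℕ) * (-s) ^ (p : ℕ))) *
        ((s - ν) * (s + ν + 1)) ^ (2 + (l : ℕ)) +
      (∑ p, shiftEntry l ν i p * (ν⁻¹ ^ (p : ℕ) * (-(s + 1)) ^ (p : ℕ))) *
        (s ^ 2) ^ (2 + (l : ℕ)) =
      ν⁻¹ ^ (i : ℕ) * (-s) ^ (i : ℕ) * ((s + ν) * (s + ν + 1)) ^ (2 + (l : ℕ)) := by
  have h := row_identity l (ν⁻¹ * s) ν⁻¹ i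
  have e1 : (s - ν) * (s + ν + 1) = ν ^ 2 * ((ν⁻¹ * s - 1) * (ν⁻¹ * s + 1 + ν⁻¹)) := by
    field_simp
  have e2 : (s + ν) * (s + ν + 1) = ν ^ 2 * ((ν⁻¹ * s + 1) * (ν⁻¹ * s + 1 + ν⁻¹)) := by
    field_simp
  have e3 : s ^ 2 = ν ^ 2 * (ν⁻¹ * s) ^ 2 := by
    field_simp
  have e4 : -(ν⁻¹ * s + ν⁻¹) = ν⁻¹ * -(s + 1) := by ring
  have e5 : -(ν⁻¹ * s) = ν⁻¹ * -s := by ring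
  rw [e4, e5] at h
  simp only [mul_pow ν⁻¹] at h
  rw [e1, e2, e3, mul_pow (ν ^ 2), mul_pow (ν ^ 2), mul_pow (ν ^ 2)]
  simp only [shiftEntry, ← inv_pow]
  simp only [← mul_pow ν⁻¹] at h ⊢
  linear_combination (ν ^ 2) ^ (2 + (l : ℕ)) * h

/-! ### Analytic functions of polynomial growth. -/

/-- `g` is analytic on the right half-plane and of polynomial growth on `1 / 2 ≤ re s`. -/
structure PolyGrowth (g : ℂ → ℂ) : Prop where
  analyticAt : ∀ s : ℂ, 0 < s.re → AnalyticAt ℂ g s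
  bound : ∃ (C : ℝ) (N : ℕ), 0 ≤ C ∧ ∀ s : ℂ, 1 / 2 ≤ s.re → ‖g s‖ ≤ C * (1 + ‖s‖) ^ N

namespace PolyGrowth

theorem mul {f g : ℂ → ℂ} (hf : PolyGrowth f) (hg : PolyGrowth g) :
    PolyGrowth (fun s => f s * g s) := by
  obtain ⟨C, N, hC, h1⟩ := hf.bound
  obtain ⟨D, M, hD, h2⟩ := hg.bound
  refine ⟨fun s hs => (hf.analyticAt s hs).mul (hg.analyticAt s hs), C * D, N + M,
    mul_nonneg hC hD, fun s hs => ?_⟩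
  rw [norm_mul]
  calc ‖f s‖ * ‖g s‖ ≤ (C * (1 + ‖s‖) ^ N) * (D * (1 + ‖s‖) ^ M) :=
        mul_le_mul (h1 s hs) (h2 s hs) (norm_nonneg _) (by positivity)
    _ = _ := by ring

theorem add {f g : ℂ → ℂ} (hf : PolyGrowth f) (hg : PolyGrowth g) :
    PolyGrowth (fun s => f s + g s) := by
  obtain ⟨C, N, hC, h1⟩ := hf.bound
  obtain ⟨D, M, hD, h2⟩ := hg.bound
  refine ⟨fun s hs => (hf.analyticAt s hs).add (hg.analyticAt s hs), C + D, N + M,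
    add_nonneg hC hD, fun s hs => (norm_add_le _ _).trans ?_⟩
  have h : 1 ≤ 1 + ‖s‖ := by linarith [norm_nonneg s]
  calc ‖f s‖ + ‖g s‖ ≤ C * (1 + ‖s‖) ^ (N + M) + D * (1 + ‖s‖) ^ (N + M) := by
        refine add_le_add ((h1 s hs).trans ?_) ((h2 s hs).trans ?_) <;> gcongr <;> simp
    _ = _ := by ring

theorem const (c : ℂ) : PolyGrowth (fun _ => c) :=
  ⟨fun _ _ => analyticAt_const, ‖c‖, 0, norm_nonneg _, fun s _ => by simp⟩

theorem ident : PolyGrowth (fun s => s) :=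
  ⟨fun _ _ => analyticAt_id, 1, 1, zero_le_one, fun s _ => by simp⟩

theorem neg {f : ℂ → ℂ} (hf : PolyGrowth f) : PolyGrowth (fun s => -f s) := by
  simpa using (const (-1)).mul hf

theorem pow {f : ℂ → ℂ} (hf : PolyGrowth f) (n : ℕ) : PolyGrowth (fun s => f s ^ n) := by
  induction n with
  | zero => simpa using const 1
  | succ n ih => simpa only [pow_succ] using ih.mul hf

theorem sum {ι : Type*} (I : Finset ι) {f : ι → ℂ → ℂ} (hf : ∀ i ∈ I, PolyGrowth (f i)) :
    PolyGrowth (fun s => ∑ i ∈ I, f i s) := by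
  classical
  induction I using Finset.induction_on with
  | empty => simpa using const 0
  | insert a I ha ih =>
    simp only [Finset.sum_insert ha]
    exact (hf a (by simp)).add (ih fun i hi => hf i (by simp [hi]))

theorem comp_add_one {f : ℂ → ℂ} (hf : PolyGrowth f) : PolyGrowth (fun s => f (s + 1)) := by
  obtain ⟨C, N, hC, h1⟩ := hf.bound
  refine ⟨fun s hs => ?_, C * 2 ^ N, N, by positivity, fun s hs => ?_⟩
  · exact (hf.analyticAt (s + 1) (by simp; linarith)).fun_comp (f := fun s => s + 1)
      (analyticAt_id.add analyticAt_const)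
  · refine (h1 (s + 1) (by simp; linarith)).trans ?_
    rw [mul_assoc, ← mul_pow]
    gcongr
    have := norm_add_le s 1
    simp only [norm_one] at this
    linarith [norm_nonneg s]

/-- Cauchy's estimate on the disc of radius 1/2 about n + 1, which stays in re s ≥ 1/2; there 1 +
‖s‖ ≤ 3(n + 1). -/
theorem iteratedDeriv_bound {f : ℂ → ℂ} (hf : PolyGrowth f) (i : ℕ) :
    ∃ (K : ℝ) (N : ℕ), 0 ≤ K ∧
      ∀ n : ℕ, ‖iteratedDeriv i f ((n + 1 : ℕ) : ℂ)‖ ≤ K * ((n + 1 : ℕ) : ℝ) ^ N := by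
  obtain ⟨C, N, hC, h1⟩ := hf.bound
  refine ⟨i.factorial * (C * 3 ^ N) / (1 / 2) ^ i, N, by positivity, fun n => ?_⟩
  have hre : ∀ s ∈ Metric.closedBall ((n + 1 : ℕ) : ℂ) (1 / 2), 1 / 2 ≤ s.re := by
    intro s hs
    rw [Metric.mem_closedBall, dist_eq_norm] at hs
    have h := (Complex.abs_re_le_norm _).trans hs
    simp only [Complex.sub_re, Complex.natCast_re] at h
    have := (abs_le.1 h).1
    push_cast at this
    have hn : (0 : ℝ) ≤ n := n.cast_nonneg
    linarith
  have hd : DiffContOnCl ℂ f (Metric.ball ((n + 1 : ℕ) : ℂ) (1 / 2)) := by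
    refine DifferentiableOn.diffContOnCl fun s hs => ?_
    have := hre s (Metric.closure_ball_subset_closedBall hs)
    exact (hf.analyticAt s (by linarith)).differentiableAt.differentiableWithinAt
  refine (Complex.norm_iteratedDeriv_le_of_forall_mem_sphere_norm_le i
    (C := C * (3 * ((n + 1 : ℕ) : ℝ)) ^ N) (by norm_num) hd fun s hs => ?_).trans
    (le_of_eq ?_)
  · refine (h1 s (hre s (Metric.sphere_subset_closedBall hs))).trans ?_
    gcongr
    rw [Metric.mem_sphere, dist_eq_norm] at hs
    have := norm_sub_norm_le s ((n + 1 : ℕ) : ℂ)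
    rw [hs, Complex.norm_natCast] at this
    have hn : (1 : ℝ) ≤ (n + 1 : ℕ) := by simp
    linarith
  · rw [mul_pow]; ring

end PolyGrowth

/-! ### Series in inverse powers, with derivatives and logarithms. -/

theorem summable_succ_pow_mul_geometric (N : ℕ) {r : ℝ} (hr : ‖r‖ < 1) :
    Summable fun n : ℕ => ((n + 1 : ℕ) : ℝ) ^ N * r ^ (n + 1) :=
  (summable_nat_add_iff (f := fun n : ℕ => (n : ℝ) ^ N * r ^ n) 1).2
    (summable_pow_mul_geometric_of_norm_lt_one N hr)

theorem summable_inv_pow_mul {a : ℕ → ℂ} {K : ℝ} {N : ℕ}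
    (ha : ∀ n, ‖a n‖ ≤ K * ((n + 1 : ℕ) : ℝ) ^ N) {w : ℂ} (hw : 1 < ‖w‖) :
    Summable fun n : ℕ => (w ^ (n + 1))⁻¹ * a n := by
  have hr : ‖‖w‖⁻¹‖ < 1 := by
    rw [norm_inv, norm_norm]
    exact inv_lt_one_of_one_lt₀ hw
  have hs := (summable_succ_pow_mul_geometric N hr).mul_left K
  refine Summable.of_norm_bounded hs fun n => ?_
  rw [norm_mul, norm_inv, norm_pow, inv_pow, mul_comm, ← mul_assoc]
  gcongr
  exact ha n

theorem hasDerivAt_tsum_inv_pow {a : ℕ → ℂ} {K : ℝ} {N : ℕ}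
    (ha : ∀ n, ‖a n‖ ≤ K * ((n + 1 : ℕ) : ℝ) ^ N) {z : ℂ} (hz : 1 < ‖z‖) :
    HasDerivAt (fun w => ∑' n : ℕ, (w ^ (n + 1))⁻¹ * a n)
      ((∑' n : ℕ, (z ^ (n + 1))⁻¹ * (-((n + 1 : ℕ) : ℂ) * a n)) / z) z := by
  -- ρ lies midway between 1 and ‖z‖, so a whole ball about z has ‖w‖ ≥ ρ > 1 and one geometric
  -- majorant serves for all derived terms on it.
  set ρ : ℝ := (1 + ‖z‖) / 2 with hρ
  have hρ1 : 1 < ρ := by linarith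
  have hr : ‖ρ⁻¹‖ < 1 := by
    rw [norm_inv, Real.norm_of_nonneg (by linarith)]
    exact inv_lt_one_of_one_lt₀ hρ1
  have hu := (summable_succ_pow_mul_geometric (N + 1) hr).mul_left K
  have hball : ∀ w ∈ Metric.ball z ((‖z‖ - 1) / 2), ρ ≤ ‖w‖ := by
    intro w hw
    rw [Metric.mem_ball, dist_comm, dist_eq_norm] at hw
    have := norm_sub_norm_le z w
    linarith
  rw [← tsum_div_const]
  refine hasDerivAt_tsum_of_isPreconnected hu Metric.isOpen_ball
    (convex_ball z ((‖z‖ - 1) / 2)).isPreconnected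
    (g' := fun n w => (w ^ (n + 1))⁻¹ * (-((n + 1 : ℕ) : ℂ) * a n) / w)
    (fun n w hw => ?_) (fun n w hw => ?_) (Metric.mem_ball_self (by linarith))
    (summable_inv_pow_mul ha hz) (Metric.mem_ball_self (by linarith))
  · have hw0 : w ≠ 0 := norm_pos_iff.1 (by linarith [hball w hw])
    have h := ((hasDerivAt_pow (n + 1) w).inv (pow_ne_zero _ hw0)).mul_const (a n)
    refine h.congr_deriv ?_
    simp only [Nat.add_sub_cancel]
    field_simp
    ring
  · have hw1 := hball w hw
    have hK : 0 ≤ K * ((n + 1 : ℕ) : ℝ) ^ N := (norm_nonneg _).trans (ha n)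
    rw [norm_div, norm_mul, norm_mul, norm_neg, norm_inv, norm_pow, Complex.norm_natCast]
    refine (div_le_self (by positivity) (by linarith)).trans ?_
    calc (‖w‖ ^ (n + 1))⁻¹ * (((n + 1 : ℕ) : ℝ) * ‖a n‖)
        ≤ (ρ ^ (n + 1))⁻¹ * (((n + 1 : ℕ) : ℝ) * (K * ((n + 1 : ℕ) : ℝ) ^ N)) := by
          gcongr
          exact ha n
      _ = K * (((n + 1 : ℕ) : ℝ) ^ (N + 1) * ρ⁻¹ ^ (n + 1)) := by
          rw [inv_pow]; ring

/-- `∑_{t ≥ 1} w⁻ᵗ g⁽ⁱ⁾(t)` -/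
noncomputable def jetSum (i : ℕ) (g : ℂ → ℂ) (w : ℂ) : ℂ :=
  ∑' n : ℕ, (w ^ (n + 1))⁻¹ * iteratedDeriv i g ((n + 1 : ℕ) : ℂ)

theorem PolyGrowth.summable {g : ℂ → ℂ} (hg : PolyGrowth g) (i : ℕ) {w : ℂ} (hw : 1 < ‖w‖) :
    Summable fun n : ℕ => (w ^ (n + 1))⁻¹ * iteratedDeriv i g ((n + 1 : ℕ) : ℂ) := by
  obtain ⟨K, N, -, h⟩ := hg.iteratedDeriv_bound i
  exact summable_inv_pow_mul h hw

theorem natCast_succ_re_pos (n : ℕ) : 0 < ((n + 1 : ℕ) : ℂ).re := by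
  rw [Complex.natCast_re]; positivity

/-- The right half-plane is open and contains every summation point, so agreement there also fixes
the derivatives. The relations for R are available only there, away from its poles. -/
theorem jetSum_congr {f g : ℂ → ℂ} (h : ∀ s : ℂ, 0 < s.re → f s = g s) (i : ℕ) (w : ℂ) :
    jetSum i f w = jetSum i g w := by
  refine tsum_congr fun n => ?_
  congr 1
  refine Filter.EventuallyEq.iteratedDeriv_eq i ?_
  filter_upwards [(isOpen_lt continuous_const Complex.continuous_re).mem_nhds
    (natCast_succ_re_pos n)] with s hs using h s hs

theorem jetSum_sum {ι : Type*} (I : Finset ι) (c : ι → ℂ) {f : ι → ℂ → ℂ}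
    (hf : ∀ p ∈ I, PolyGrowth (f p)) (i : ℕ) {w : ℂ} (hw : 1 < ‖w‖) :
    jetSum i (fun s => ∑ p ∈ I, c p * f p s) w = ∑ p ∈ I, c p * jetSum i (f p) w := by
  simp only [jetSum, ← tsum_mul_left]
  rw [← Summable.tsum_finsetSum fun p hp => ((hf p hp).summable i hw).mul_left (c p)]
  refine tsum_congr fun n => ?_
  rw [iteratedDeriv_fun_sum (f := fun p s => c p * f p s) fun p hp =>
    (analyticAt_const.mul ((hf p hp).analyticAt _ (natCast_succ_re_pos n))).contDiffAt,
    Finset.mul_sum]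
  refine Finset.sum_congr rfl fun p _ => ?_
  rw [iteratedDeriv_const_mul_field]
  ring

theorem jetSum_add {f g : ℂ → ℂ} (hf : PolyGrowth f) (hg : PolyGrowth g) (i : ℕ) {w : ℂ}
    (hw : 1 < ‖w‖) :
    jetSum i (fun s => f s + g s) w = jetSum i f w + jetSum i g w := by
  have := jetSum_sum (Finset.univ : Finset (Fin 2)) (fun _ => 1) (f := ![f, g])
    (by intro p _; fin_cases p <;> assumption) i hw
  simpa using this

/-- Multiplication by `w` shifts the summation index. -/
theorem mul_jetSum {g : ℂ → ℂ} (hg : PolyGrowth g) {i : ℕ} (h1 : iteratedDeriv i g 1 = 0)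
    {w : ℂ} (hw : 1 < ‖w‖) :
    w * jetSum i g w = jetSum i (fun s => g (s + 1)) w := by
  have hw0 : w ≠ 0 := norm_pos_iff.1 (by linarith)
  rw [jetSum, (hg.summable i hw).tsum_eq_zero_add, jetSum]
  simp only [zero_add, Nat.cast_one, h1, mul_zero]
  rw [← tsum_mul_left]
  refine tsum_congr fun n => ?_
  rw [iteratedDeriv_comp_add_const]
  push_cast
  rw [pow_succ w (n + 1)]
  field_simp

/-- Leibniz' rule with a linear factor leaves two terms. For i = 0 the truncated index i - 1 is
harmless, its coefficient being 0. -/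
theorem iteratedDeriv_neg_id_mul {g : ℂ → ℂ} {s : ℂ} (hg : AnalyticAt ℂ g s) (i : ℕ) :
    iteratedDeriv i (fun s => -s * g s) s =
      -s * iteratedDeriv i g s - i * iteratedDeriv (i - 1) g s := by
  have e : (fun s => -s * g s) = fun s => (-1) * ((fun s => s) s * g s) := by
    ext; ring
  rw [e, iteratedDeriv_const_mul_field,
    iteratedDeriv_fun_mul contDiffAt_fun_id hg.contDiffAt]
  rcases i with _ | i
  · simp
  · rw [Finset.sum_range_succ', Finset.sum_range_succ']
    simp [iteratedDeriv_fun_id]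
    ring

theorem PolyGrowth.hasDerivAt_jetSum {g : ℂ → ℂ} (hg : PolyGrowth g) (i : ℕ) {w : ℂ}
    (hw : 1 < ‖w‖) :
    HasDerivAt (jetSum i g)
      ((jetSum i (fun s => -s * g s) w + i * jetSum (i - 1) g w) / w) w := by
  obtain ⟨K, N, -, h⟩ := hg.iteratedDeriv_bound i
  refine (hasDerivAt_tsum_inv_pow h hw).congr_deriv ?_
  congr 1
  have h2 := (ident.neg.mul hg).summable i hw
  rw [jetSum, jetSum, ← tsum_mul_left, ← h2.tsum_add ((hg.summable (i - 1) hw).mul_left _)]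
  refine tsum_congr fun n => ?_
  rw [iteratedDeriv_neg_id_mul (hg.analyticAt _ (natCast_succ_re_pos n))]
  ring

/-- `∑_{t ≥ 1} (d / dt)ʲ (exp (-t L) g(t))` where `exp L = w` -/
noncomputable def logSum (j : ℕ) (g : ℂ → ℂ) (L w : ℂ) : ℂ :=
  ∑ i ∈ Finset.range (j + 1), (j.choose i : ℂ) * (-L) ^ (j - i) * jetSum i g w

/-- δ commutes with d/dt and multiplies exp(-tL) by -t. In coordinates, the lower-order terms from
`hasDerivAt_jetSum` cancel against the derivatives of the powers of L; this is checked for each j ≤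
3, the range needed when l ≤ 2. -/
theorem PolyGrowth.hasDerivAt_logSum {g : ℂ → ℂ} (hg : PolyGrowth g) {j : ℕ} (hj : j ≤ 3)
    {L : ℂ → ℂ} {w : ℂ} (hw : 1 < ‖w‖) (hL : HasDerivAt L w⁻¹ w) :
    HasDerivAt (fun w => logSum j g (L w) w) (logSum j (fun s => -s * g s) (L w) w / w) w := by
  have h : HasDerivAt (fun w => logSum j g (L w) w) _ w := HasDerivAt.fun_sum fun i _ =>
    ((hL.neg.fun_pow (j - i)).const_mul (j.choose i : ℂ)).fun_mul (hg.hasDerivAt_jetSum i hw)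
  refine h.congr_deriv ?_
  have hw0 : w ≠ 0 := norm_pos_iff.1 (by linarith)
  interval_cases j <;> simp [logSum, Finset.sum_range_succ, Nat.choose] <;> field_simp <;> ring

theorem logSum_congr {f g : ℂ → ℂ} (h : ∀ s : ℂ, 0 < s.re → f s = g s) (j : ℕ) (L w : ℂ) :
    logSum j f L w = logSum j g L w := by
  simp only [logSum, jetSum_congr h]

theorem logSum_sum {ι : Type*} (I : Finset ι) (c : ι → ℂ) {f : ι → ℂ → ℂ}
    (hf : ∀ p ∈ I, PolyGrowth (f p)) (j : ℕ) (L : ℂ) {w : ℂ} (hw : 1 < ‖w‖) :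
    logSum j (fun s => ∑ p ∈ I, c p * f p s) L w = ∑ p ∈ I, c p * logSum j (f p) L w := by
  simp only [logSum, jetSum_sum I c hf _ hw, Finset.mul_sum]
  rw [Finset.sum_comm]
  exact Finset.sum_congr rfl fun p _ => Finset.sum_congr rfl fun i _ => by ring

theorem logSum_add {f g : ℂ → ℂ} (hf : PolyGrowth f) (hg : PolyGrowth g) (j : ℕ) (L : ℂ)
    {w : ℂ} (hw : 1 < ‖w‖) :
    logSum j (fun s => f s + g s) L w = logSum j f L w + logSum j g L w := by
  simp only [logSum, jetSum_add hf hg _ hw, mul_add, Finset.sum_add_distrib]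

theorem mul_logSum {g : ℂ → ℂ} (hg : PolyGrowth g) {j : ℕ}
    (h1 : ∀ i ≤ j, iteratedDeriv i g 1 = 0) (L : ℂ) {w : ℂ} (hw : 1 < ‖w‖) :
    w * logSum j g L w = logSum j (fun s => g (s + 1)) L w := by
  rw [logSum, logSum, Finset.mul_sum]
  refine Finset.sum_congr rfl fun i hi => ?_
  rw [← mul_jetSum hg (h1 i (by have := Finset.mem_range.1 hi; lia)) hw]
  ring

/-! ### The rational function R. -/

theorem ratR_zero (s : ℂ) : ratR s 0 = s⁻¹ := by
  simp [ratR]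

theorem ratR_succ (s : ℂ) (ν : ℕ) :
    ratR s (ν + 1) = ratR s ν * ((s - (ν + 1)) / (s + (ν + 1))) := by
  rw [ratR, ratR, Finset.prod_Icc_succ_top (by lia), Finset.prod_range_succ, mul_div_mul_comm]
  push_cast
  rfl

theorem add_natCast_ne_zero {s : ℂ} (hs : 0 < s.re) (n : ℕ) : s + n ≠ 0 := by
  intro h
  have := congrArg Complex.re h
  simp only [Complex.add_re, Complex.natCast_re, Complex.zero_re] at this
  have hn : (0 : ℝ) ≤ n := n.cast_nonneg
  linarith

/-- Under s ↦ s + 1 the numerator gains the factor s, while the denominator loses s and gains the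
two factors at the far end. -/
theorem ratR_add_one {s : ℂ} (hs : 0 < s.re) (μ : ℕ) :
    ratR (s + 1) (μ + 1) =
      ratR s μ * (s ^ 2 / ((s + (μ + 1)) * (s + (μ + 1) + 1))) := by
  have hs0 : s ≠ 0 := by simpa using add_natCast_ne_zero hs 0
  induction μ with
  | zero =>
    rw [ratR_succ, ratR_zero, ratR_zero]
    have h1 : s + 1 ≠ 0 := by simpa using add_natCast_ne_zero hs 1
    simp only [Nat.cast_zero, zero_add, add_sub_cancel_right]
    field_simp
  | succ μ ih =>
    rw [ratR_succ, ih, ratR_succ]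
    have h1 : s + (μ + 1) ≠ 0 := by simpa using add_natCast_ne_zero hs (μ + 1)
    have h2 : s + (μ + 1) + 1 ≠ 0 := by
      simpa [← add_assoc] using add_natCast_ne_zero hs (μ + 1 + 1)
    have h3 : s + (μ + 1) + 1 + 1 ≠ 0 := by
      simpa [← add_assoc] using add_natCast_ne_zero hs (μ + 1 + 1 + 1)
    push_cast
    have e1 : s + 1 + ((μ : ℂ) + 1 + 1) = s + (μ + 1) + 1 + 1 := by ring
    have e2 : s + ((μ : ℂ) + 1 + 1) = s + (μ + 1) + 1 := by ring
    rw [e1, e2]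
    field_simp
    ring

theorem polyGrowth_ratR (ν : ℕ) : PolyGrowth fun s => ratR s ν := by
  -- For re s > 0 the point s is at least as close to n as to -n, so each such factor is bounded by
  -- 1.
  have key : ∀ n : ℕ, PolyGrowth fun s => (s - n) / (s + n) := by
    intro n
    refine ⟨fun s hs => (analyticAt_id.sub analyticAt_const).div
      (analyticAt_id.add analyticAt_const) (add_natCast_ne_zero hs n), 1, 0, zero_le_one,
      fun s hs => ?_⟩
    rw [norm_div, pow_zero, mul_one]
    refine div_le_one_of_le₀ ?_ (norm_nonneg _)
    rw [Complex.norm_def, Complex.norm_def]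
    refine Real.sqrt_le_sqrt ?_
    have hn : (0 : ℝ) ≤ n := n.cast_nonneg
    simp only [Complex.normSq_apply, Complex.sub_re, Complex.sub_im, Complex.add_re,
      Complex.add_im, Complex.natCast_re, Complex.natCast_im]
    nlinarith
  induction ν with
  | zero =>
    simp only [ratR_zero]
    refine ⟨fun s hs => analyticAt_inv (by simpa using add_natCast_ne_zero hs 0), 2, 0,
      zero_le_two, fun s hs => ?_⟩
    rw [norm_inv, pow_zero, mul_one]
    have h := hs.trans ((le_abs_self _).trans (Complex.abs_re_le_norm s))
    calc ‖s‖⁻¹ ≤ (1 / 2)⁻¹ := by gcongr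
      _ = 2 := by norm_num
  | succ ν ih =>
    simp only [ratR_succ]
    exact ih.mul (by simpa using key (ν + 1))

/-- The zeros of `R(·, ν)` at `1, …, ν` make the low derivatives of its powers vanish. -/
theorem iteratedDeriv_mul_ratR_pow_eq_zero {c : ℂ → ℂ} {ν m j t : ℕ} (hj : j < m)
    (ht : t ∈ Finset.Icc 1 ν) (hc : AnalyticAt ℂ c t) :
    iteratedDeriv j (fun s => c s * ratR s ν ^ m) t = 0 := by
  have ht0 : 0 < (t : ℂ).re := by
    rw [Complex.natCast_re]
    exact_mod_cast (Finset.mem_Icc.1 ht).1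
  have hR := (polyGrowth_ratR ν).analyticAt t ht0
  have hf : AnalyticAt ℂ (fun s => c s * ratR s ν ^ m) t := hc.mul (hR.pow m)
  refine (natCast_le_analyticOrderAt_iff_iteratedDeriv_eq_zero hf).1 ?_ j hj
  rw [natCast_le_analyticOrderAt hf]
  refine ⟨fun s => c s * ((∏ j ∈ (Finset.Icc 1 ν).erase t, (s - (j : ℂ))) /
    ∏ j ∈ Finset.range (ν + 1), (s + (j : ℂ))) ^ m, ?_, Filter.Eventually.of_forall fun s => ?_⟩
  · refine hc.mul ((AnalyticAt.div ?_ ?_ ?_).pow m)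
    · exact Finset.analyticAt_fun_prod _ fun n _ => analyticAt_id.sub analyticAt_const
    · exact Finset.analyticAt_fun_prod _ fun n _ => analyticAt_id.add analyticAt_const
    · exact Finset.prod_ne_zero_iff.2 fun n _ => add_natCast_ne_zero ht0 n
  · simp only [ratR]
    rw [← Finset.mul_prod_erase _ _ ht, smul_eq_mul, mul_div_assoc, mul_pow]
    ring

/-- The terms t = 1, …, ν may be added freely: R(·, ν)^(2+l) vanishes there to order greater than j.
-/
theorem serR_eq_jetSum {l j : ℕ} (hj : j < 2 + l) (z : ℂ) (hz : 1 < ‖z‖) (ν : ℕ) :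
    serR l j z ν = jetSum j (fun s => ratR s ν ^ (2 + l)) z := by
  have hs := ((polyGrowth_ratR ν).pow (2 + l)).summable j hz
  rw [jetSum, ← hs.sum_add_tsum_nat_add ν, Finset.sum_eq_zero, zero_add, serR]
  · refine tsum_congr fun n => ?_
    rw [show ν + 1 + n = n + ν + 1 by ring]
  · intro n hn
    have h := iteratedDeriv_mul_ratR_pow_eq_zero (c := fun _ => 1) (ν := ν) (t := n + 1) hj
      (by have := Finset.mem_range.1 hn; simp; lia) analyticAt_const
    simp only [one_mul] at h
    rw [h, mul_zero]

/-! ### Solutions of the recursion, and those given by the series. -/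

/-- A family `Φ ν p` (with `p` counting applications of `δ = z d/dz`) which near `z` is closed
under `δ` and at `z` satisfies the matrix recursion in `ν`. -/
structure IsSolution (l : Fin 3) (z : ℂ) (Φ : ℕ → ℕ → ℂ → ℂ) : Prop where
  hasDerivAt : ∀ ν, ∀ᶠ w in nhds z, ∀ p, HasDerivAt (Φ ν p) (Φ ν (p + 1) w / w) w
  row : ∀ (ν : ℕ) (i : Fin (4 + 2 * (l : ℕ))),
    ∑ p, matA l z ((ν + 1 : ℕ) : ℂ) i p * (((ν + 1 : ℕ) : ℂ)⁻¹ ^ (p : ℕ) * Φ (ν + 1) p z) =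
      ((ν + 1 : ℕ) : ℂ)⁻¹ ^ (i : ℕ) * Φ ν i z

namespace IsSolution

variable {l : Fin 3} {z : ℂ} {Φ Ψ : ℕ → ℕ → ℂ → ℂ}

theorem add (hΦ : IsSolution l z Φ) (hΨ : IsSolution l z Ψ) :
    IsSolution l z fun ν p w => Φ ν p w + Ψ ν p w := by
  refine ⟨fun ν => ?_, fun ν i => ?_⟩
  · filter_upwards [hΦ.hasDerivAt ν, hΨ.hasDerivAt ν] with w h1 h2 p
    simpa only [add_div] using (h1 p).fun_add (h2 p)
  · simp only [mul_add, Finset.sum_add_distrib, hΦ.row, hΨ.row]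

theorem const_mul (hΦ : IsSolution l z Φ) (c : ℂ) :
    IsSolution l z fun ν p w => c * Φ ν p w := by
  refine ⟨fun ν => ?_, fun ν i => ?_⟩
  · filter_upwards [hΦ.hasDerivAt ν] with w h1 p
    simpa only [mul_div_assoc] using (h1 p).const_mul c
  · have h : ∀ a b d : ℂ, a * (b * (c * d)) = c * (a * (b * d)) := fun a b d => by ring
    simp only [h, ← Finset.mul_sum, hΦ.row]
    ring

/-- Equality is carried on a neighbourhood, not only at z, because each further application of δ
differentiates it. -/
theorem deltaOp_iterate (hΦ : IsSolution l z Φ) {f : ℂ → ℂ} {ν : ℕ}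
    (hz : z ≠ 0) (hf : ∀ᶠ w in nhds z, f w = Φ ν 0 w) (p : ℕ) :
    ∀ᶠ w in nhds z, (deltaOp ν)^[p] f w = (ν : ℂ)⁻¹ ^ p * Φ ν p w := by
  induction p with
  | zero => simpa using hf
  | succ p ih =>
    filter_upwards [ih.eventually_nhds, hΦ.hasDerivAt ν, isOpen_ne.mem_nhds hz] with w h1 h2 hw
    rw [Function.iterate_succ_apply', deltaOp, Filter.EventuallyEq.deriv_eq h1,
      ((h2 p).const_mul _).deriv, pow_succ]
    have hw : w ≠ 0 := hw
    field_simp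

theorem mulVec_eq (hΦ : IsSolution l z Φ) {f : ℕ → ℂ → ℂ} (hz : z ≠ 0)
    (hf : ∀ ν, ∀ᶠ w in nhds z, f ν w = Φ ν 0 w) {ν : ℕ} (hν : 2 ≤ ν) :
    (matA l z (ν : ℂ)).mulVec (fun i => (deltaOp ν)^[(i : ℕ)] (f ν) z) =
      (matT (4 + 2 * (l : ℕ)) (1 - (ν : ℂ)⁻¹)).mulVec
        (fun i => (deltaOp (ν - 1))^[(i : ℕ)] (f (ν - 1)) z) := by
  obtain ⟨μ, rfl⟩ : ∃ μ, ν = μ + 1 := ⟨ν - 1, by lia⟩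
  have hμ : (μ : ℂ) ≠ 0 := Nat.cast_ne_zero.2 (by lia)
  have hμ1 : ((μ + 1 : ℕ) : ℂ) ≠ 0 := Nat.cast_ne_zero.2 (by lia)
  ext i
  simp only [Nat.add_sub_cancel, matT, Matrix.mulVec_diagonal]
  simp only [Matrix.mulVec, dotProduct, (hΦ.deltaOp_iterate hz (hf _) _).self_of_nhds, hΦ.row]
  -- Both sides are i-th powers, by ν⁻¹ = (1 - ν⁻¹)(ν - 1)⁻¹; this is where T_{1-1/ν} comes from,
  -- and where ν ≥ 2 enters.
  rw [← mul_assoc, ← mul_pow]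
  congr 2
  push_cast at hμ1 ⊢
  field_simp
  ring

end IsSolution

theorem polyGrowth_neg_pow_mul_ratR (p ν m : ℕ) :
    PolyGrowth fun s => (-s) ^ p * ratR s ν ^ m :=
  (PolyGrowth.ident.neg.pow p).mul ((polyGrowth_ratR ν).pow m)

theorem isSolution_logSum (l : Fin 3) {j : ℕ} (hj : j < 2 + (l : ℕ)) {z : ℂ} (hz : 1 < ‖z‖)
    {L : ℂ → ℂ} (hL : ∀ᶠ w in nhds z, HasDerivAt L w⁻¹ w) :
    IsSolution l z fun ν p w =>
      logSum j (fun s => (-s) ^ p * ratR s ν ^ (2 + (l : ℕ))) (L w) w := by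
  refine ⟨fun ν => ?_, fun μ i => ?_⟩
  · filter_upwards [hL, (isOpen_lt continuous_const continuous_norm).mem_nhds hz] with w h1 h2 p
    refine ((polyGrowth_neg_pow_mul_ratR p ν (2 + (l : ℕ))).hasDerivAt_logSum
      (by lia) h2 h1).congr_deriv ?_
    congr 2
    ext s
    ring
  · set ν : ℂ := ((μ + 1 : ℕ) : ℂ) with hν
    set m := 2 + (l : ℕ)
    have hν0 : ν ≠ 0 := Nat.cast_ne_zero.2 (by lia)
    have hg : ∀ p ∈ (Finset.univ : Finset (Fin (4 + 2 * (l : ℕ)))),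
        PolyGrowth fun s => (-s) ^ (p : ℕ) * ratR s (μ + 1) ^ m :=
      fun p _ => polyGrowth_neg_pow_mul_ratR p (μ + 1) m
    have hW : PolyGrowth fun s => ∑ p, (shiftEntry l ν i p * ν⁻¹ ^ (p : ℕ)) *
        ((-s) ^ (p : ℕ) * ratR s (μ + 1) ^ m) :=
      PolyGrowth.sum _ fun p hp => (PolyGrowth.const _).mul (hg p hp)
    have hS : PolyGrowth fun s => ∑ p, ((matS l i p : ℂ) * ν⁻¹ ^ (p : ℕ)) *
        ((-s) ^ (p : ℕ) * ratR s (μ + 1) ^ m) :=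
      PolyGrowth.sum _ fun p hp => (PolyGrowth.const _).mul (hg p hp)
    have hvanish : ∀ q ≤ j, iteratedDeriv q (fun s => ∑ p, (shiftEntry l ν i p * ν⁻¹ ^ (p : ℕ)) *
        ((-s) ^ (p : ℕ) * ratR s (μ + 1) ^ m)) 1 = 0 := by
      intro q hq
      have e : (fun s => ∑ p, (shiftEntry l ν i p * ν⁻¹ ^ (p : ℕ)) *
          ((-s) ^ (p : ℕ) * ratR s (μ + 1) ^ m)) =
          fun s => (∑ p, (shiftEntry l ν i p * ν⁻¹ ^ (p : ℕ)) * (-s) ^ (p : ℕ)) *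
            ratR s (μ + 1) ^ m := by
        ext s
        rw [Finset.sum_mul]
        exact Finset.sum_congr rfl fun p _ => by ring
      have h := iteratedDeriv_mul_ratR_pow_eq_zero (ν := μ + 1) (t := 1)
        (c := fun s => ∑ p, (shiftEntry l ν i p * ν⁻¹ ^ (p : ℕ)) * (-s) ^ (p : ℕ))
        (lt_of_le_of_lt hq hj) (by simp) (Finset.analyticAt_fun_sum _ fun p _ =>
          analyticAt_const.mul (analyticAt_id.neg.pow _))
      rwa [e, ← Nat.cast_one (R := ℂ)]
    have e1 : ∀ p : Fin (4 + 2 * (l : ℕ)), ∀ a : ℂ, matA l z ν i p * (ν⁻¹ ^ (p : ℕ) * a) =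
        ((matS l i p : ℂ) * ν⁻¹ ^ (p : ℕ)) * a +
          z * ((shiftEntry l ν i p * ν⁻¹ ^ (p : ℕ)) * a) := by
      intro p a
      rw [matA_apply]
      ring
    simp only [e1]
    -- The S-part and the V-part each become one `logSum`; the factor z then shifts the V-part to s
    -- + 1.
    rw [Finset.sum_add_distrib, ← Finset.mul_sum, ← logSum_sum _ _ hg _ _ hz,
      ← logSum_sum _ _ hg _ _ hz, mul_logSum hW hvanish _ hz, ← logSum_add hS hW.comp_add_one _ _ hz]
    have h2 := logSum_sum (Finset.univ : Finset (Fin 1)) (fun _ => ν⁻¹ ^ (i : ℕ))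
      (f := fun _ s => (-s) ^ (i : ℕ) * ratR s μ ^ m)
      (fun _ _ => polyGrowth_neg_pow_mul_ratR i μ m) j (L z) hz
    simp only [Finset.univ_unique, Finset.sum_singleton] at h2
    rw [← h2]
    refine logSum_congr (fun s hs => ?_) _ _ _
    have h3 := row_identity_scaled l s hν0 i
    have n1 : s + ν ≠ 0 := add_natCast_ne_zero hs _
    have n2 : s + ν + 1 ≠ 0 := by
      simpa [← add_assoc, hν] using add_natCast_ne_zero hs (μ + 1 + 1)
    have r1 : ratR s (μ + 1) =
        (ratR s μ / ((s + ν) * (s + ν + 1))) * ((s - ν) * (s + ν + 1)) := by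
      rw [ratR_succ, show (μ : ℂ) + 1 = ν by simp [hν]]
      field_simp
    have r2 : ratR (s + 1) (μ + 1) = (ratR s μ / ((s + ν) * (s + ν + 1))) * s ^ 2 := by
      rw [ratR_add_one hs, show (μ : ℂ) + 1 = ν by simp [hν]]
      field_simp
    have r3 : ratR s μ = (ratR s μ / ((s + ν) * (s + ν + 1))) * ((s + ν) * (s + ν + 1)) := by
      field_simp
    rw [r1, r2]
    conv_rhs => rw [r3]
    -- Q is the common factor of R(s, ν), R(s+1, ν) and R(s, ν-1); only the polynomial identity
    -- times Q^m remains.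
    generalize (ratR s μ / ((s + ν) * (s + ν + 1))) = Q
    rw [show 2 + (l : ℕ) = m from rfl] at h3
    simp only [mul_pow Q]
    trans Q ^ m * (ν⁻¹ ^ (i : ℕ) * (-s) ^ (i : ℕ) * ((s + ν) * (s + ν + 1)) ^ m)
    · rw [← h3, mul_add (Q ^ m), Finset.sum_mul, Finset.sum_mul, Finset.mul_sum, Finset.mul_sum]
      refine congrArg₂ _ ?_ ?_ <;> exact Finset.sum_congr rfl fun p _ => by ring
    · ring

/-! ### Residues of R and the polynomial solution. -/

/-- The signed Apéry-type products `(-1)^(ν+k) C(ν,k) C(ν+k,ν)`, the residues of `R(·, ν)` at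
`-k`. -/
noncomputable def residueR (k ν : ℕ) : ℂ :=
  (-1) ^ (ν + k) * (ν.choose k : ℂ) * ((ν + k).choose ν : ℂ)

theorem residueR_succ_left (k μ : ℕ) :
    residueR (k + 1) (μ + 1) * (k + 1) ^ 2 =
      -(residueR k (μ + 1) * ((μ + 1 - k) * (μ + 1 + k + 1))) := by
  have h1 : ((μ + 1).choose (k + 1) : ℂ) * (k + 1) = (μ + 1).choose k * (μ + 1 - k) := by
    rcases le_or_gt k (μ + 1) with h | h
    · have := Nat.choose_succ_right_eq (μ + 1) k
      have h2 : ((μ + 1 - k : ℕ) : ℂ) = μ + 1 - k := by push_cast [h]; ring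
      rw [← h2]
      exact_mod_cast this
    · rw [Nat.choose_eq_zero_of_lt h, Nat.choose_eq_zero_of_lt (by lia)]
      simp
  have h3 : ((μ + 1 + (k + 1)).choose (μ + 1) : ℂ) * (k + 1) =
      (μ + 1 + k).choose (μ + 1) * (μ + 1 + k + 1) := by
    have := Nat.add_one_mul_choose_eq (μ + 1 + k) k
    rw [Nat.choose_symm_add, Nat.choose_symm_add, mul_comm _ ((μ : ℂ) + 1 + k + 1)]
    exact_mod_cast this.symm
  rw [residueR, residueR, show μ + 1 + (k + 1) = μ + 1 + k + 1 by ring, pow_succ]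
  rw [show μ + 1 + (k + 1) = μ + 1 + k + 1 by ring] at h3
  linear_combination (-(-1) ^ (μ + 1 + k)) *
    ((μ + 1 + k + 1).choose (μ + 1) * (k + 1) * h1 +
      (μ + 1).choose k * (μ + 1 - k) * h3)

theorem residueR_succ_right (k μ : ℕ) (hk : k ≤ μ + 1) :
    residueR k μ * (μ + 1 + k) = -(residueR k (μ + 1) * (μ + 1 - k)) := by
  have h1 : (μ.choose k : ℂ) * (μ + 1) = (μ + 1).choose k * (μ + 1 - k) := by
    have := Nat.choose_mul_succ_eq μ k
    have h2 : ((μ + 1 - k : ℕ) : ℂ) = μ + 1 - k := by push_cast [hk]; ring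
    rw [← h2]
    exact_mod_cast this
  have h3 : ((μ + k).choose μ : ℂ) * (μ + 1 + k) =
      (μ + 1 + k).choose (μ + 1) * (μ + 1) := by
    have := Nat.choose_mul_succ_eq (μ + k) k
    rw [show μ + k + 1 - k = μ + 1 by lia, show μ + k + 1 = μ + 1 + k by ring] at this
    rw [Nat.choose_symm_add, Nat.choose_symm_add]
    exact_mod_cast this
  have h4 : (μ : ℂ) + 1 ≠ 0 := Nat.cast_add_one_ne_zero μ
  refine mul_right_cancel₀ h4 ?_
  rw [residueR, residueR, show μ + 1 + k = μ + k + 1 by ring, pow_succ]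
  rw [show μ + 1 + k = μ + k + 1 by ring] at h3
  linear_combination ((-1) ^ (μ + k)) *
    ((μ + k).choose μ * (μ + 1 + k) * h1 + (μ + 1).choose k * (μ + 1 - k) * h3)

theorem residueR_eq_zero {k ν : ℕ} (h : ν < k) : residueR k ν = 0 := by
  simp [residueR, Nat.choose_eq_zero_of_lt h]

/-- The residue at `1 - k`, which is `0` for `k = 0`. -/
noncomputable def residueRPred : ℕ → ℕ → ℂ
  | 0, _ => 0
  | k + 1, ν => residueR k ν

/-- P is the residue at s = -k of the common factor Q, so the three relations between Q and R pass
to residues. -/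
theorem exists_residueR_eq (k μ : ℕ) (hk : k ≤ μ + 2) : ∃ P : ℂ,
    residueR k (μ + 1) = P * ((-(k : ℂ) - (μ + 1 : ℕ)) * (-(k : ℂ) + (μ + 1 : ℕ) + 1)) ∧
    residueRPred k (μ + 1) = P * (-(k : ℂ)) ^ 2 ∧
    residueR k μ = P * ((-(k : ℂ) + (μ + 1 : ℕ)) * (-(k : ℂ) + (μ + 1 : ℕ) + 1)) := by
  -- At k = μ + 2 the factor multiplying P in the first and third relations is 0, so P has to be
  -- read off from the second.
  rcases eq_or_lt_of_le hk with rfl | hk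
  · have h : (μ : ℂ) + 2 ≠ 0 := by exact_mod_cast (Nat.succ_ne_zero (μ + 1))
    refine ⟨residueR (μ + 1) (μ + 1) / (μ + 2) ^ 2, ?_, ?_, ?_⟩
    · rw [residueR_eq_zero (by lia)]
      push_cast
      ring
    · rw [residueRPred]
      push_cast
      field_simp
    · rw [residueR_eq_zero (by lia)]
      push_cast
      ring
  · have h1 : (μ : ℂ) + 1 + k ≠ 0 := by exact_mod_cast (Nat.succ_ne_zero (μ + k)) ∘ (by lia)
    have h2 : (μ : ℂ) + 1 + 1 - k ≠ 0 := by
      rw [sub_ne_zero]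
      exact_mod_cast (by lia : μ + 1 + 1 ≠ k)
    refine ⟨-residueR k (μ + 1) / ((μ + 1 + k) * (μ + 1 + 1 - k)), ?_, ?_, ?_⟩
    · push_cast
      field_simp
      ring
    · rcases k with _ | k
      · simp [residueRPred]
      · have := residueR_succ_left k μ
        rw [residueRPred]
        push_cast at h1 h2 ⊢
        rw [div_mul_eq_mul_div, eq_div_iff (mul_ne_zero h1 h2)]
        linear_combination this
    · have := residueR_succ_right k μ (by lia)
      push_cast
      rw [div_mul_eq_mul_div, eq_div_iff (mul_ne_zero h1 h2)]
      linear_combination (μ + 1 + 1 - k) * this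

/-- `δᵖ f_{l,1}` -/
noncomputable def residueSum (m ν p : ℕ) (w : ℂ) : ℂ :=
  ∑ k ∈ Finset.range (ν + 1), w ^ k * ((k : ℂ) ^ p * residueR k ν ^ m)

theorem f1_eq_residueSum (l : ℕ) (z : ℂ) (ν : ℕ) : f1 l z ν = residueSum (2 + l) ν 0 z := by
  refine Finset.sum_congr rfl fun k _ => ?_
  have h : (-1 : ℂ) ^ ((ν + k) * l) = ((-1) ^ (ν + k)) ^ (2 + l) := by
    rw [pow_mul]
    rcases neg_one_pow_eq_or ℂ (ν + k) with h | h <;> simp [h, pow_add]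
  rw [residueR, mul_pow, mul_pow, h]
  ring

theorem isSolution_residueSum (l : Fin 3) {z : ℂ} (hz : z ≠ 0) :
    IsSolution l z fun ν p w => residueSum (2 + (l : ℕ)) ν p w := by
  refine ⟨fun ν => ?_, fun μ i => ?_⟩
  · filter_upwards [isOpen_ne.mem_nhds hz] with w hw p
    have hw : w ≠ 0 := hw
    have h := HasDerivAt.fun_sum (u := Finset.range (ν + 1)) fun k _ =>
      (hasDerivAt_pow k w).mul_const ((k : ℂ) ^ p * residueR k ν ^ (2 + (l : ℕ)))
    refine h.congr_deriv ?_
    rw [residueSum, Finset.sum_div]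
    refine Finset.sum_congr rfl fun k _ => ?_
    rcases k with _ | k
    · simp
    · rw [Nat.add_sub_cancel, pow_succ w, pow_succ _ p]
      field_simp
  · set ν : ℂ := ((μ + 1 : ℕ) : ℂ) with hν
    set m := 2 + (l : ℕ) with hm
    have hν0 : ν ≠ 0 := Nat.cast_ne_zero.2 (by lia)
    have hm0 : m ≠ 0 := by lia
    -- All three sums are put on the range k ≤ μ + 2 so that they compare termwise; the added terms
    -- are zero.
    have hS : ∀ p, residueSum m (μ + 1) p z = ∑ k ∈ Finset.range (μ + 3),
        z ^ k * ((k : ℂ) ^ p * residueR k (μ + 1) ^ m) := by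
      intro p
      rw [Finset.sum_range_succ _ (μ + 2), residueR_eq_zero (by lia), residueSum]
      simp [hm0]
    have hW : ∀ p, z * residueSum m (μ + 1) p z = ∑ k ∈ Finset.range (μ + 3),
        z ^ k * ((-(-(k : ℂ) + 1)) ^ p * residueRPred k (μ + 1) ^ m) := by
      intro p
      rw [Finset.sum_range_succ' _ (μ + 2), residueSum, Finset.mul_sum]
      simp only [residueRPred, ne_eq, hm0, not_false_eq_true, zero_pow, mul_zero, add_zero]
      refine Finset.sum_congr rfl fun k _ => ?_
      push_cast
      rw [show -(-((k : ℂ) + 1) + 1) = k by ring]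
      ring
    have hR : residueSum m μ i z = ∑ k ∈ Finset.range (μ + 3),
        z ^ k * ((k : ℂ) ^ (i : ℕ) * residueR k μ ^ m) := by
      rw [Finset.sum_range_succ _ (μ + 2), Finset.sum_range_succ _ (μ + 1),
        residueR_eq_zero (by lia), residueR_eq_zero (by lia), residueSum]
      simp [hm0]
    have e1 : ∀ p : Fin (4 + 2 * (l : ℕ)),
        matA l z ν i p * (ν⁻¹ ^ (p : ℕ) * residueSum m (μ + 1) p z) =
        ∑ k ∈ Finset.range (μ + 3), z ^ k *
          ((matS l i p : ℂ) * ν⁻¹ ^ (p : ℕ) * ((k : ℂ) ^ (p : ℕ) * residueR k (μ + 1) ^ m) +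
          shiftEntry l ν i p * ν⁻¹ ^ (p : ℕ) *
            ((-(-(k : ℂ) + 1)) ^ (p : ℕ) * residueRPred k (μ + 1) ^ m)) := by
      intro p
      rw [matA_apply]
      trans (matS l i p : ℂ) * ν⁻¹ ^ (p : ℕ) * residueSum m (μ + 1) p z +
        shiftEntry l ν i p * ν⁻¹ ^ (p : ℕ) * (z * residueSum m (μ + 1) p z)
      · ring
      · rw [hW, hS, Finset.mul_sum, Finset.mul_sum, ← Finset.sum_add_distrib]
        exact Finset.sum_congr rfl fun k _ => by ring
    simp only [e1]
    rw [Finset.sum_comm, hR, Finset.mul_sum]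
    refine Finset.sum_congr rfl fun k hk => ?_
    obtain ⟨P, h1, h2, h3⟩ := exists_residueR_eq k μ (by have := Finset.mem_range.1 hk; lia)
    have h4 := row_identity_scaled l (-(k : ℂ)) hν0 i
    rw [← hm, neg_neg] at h4
    rw [h1, h2, h3, ← hν]
    simp only [mul_pow P]
    trans z ^ k * (P ^ m * (ν⁻¹ ^ (i : ℕ) * (k : ℂ) ^ (i : ℕ) *
      ((-(k : ℂ) + ν) * (-(k : ℂ) + ν + 1)) ^ m))
    · rw [← h4, Finset.sum_mul, Finset.sum_mul, ← Finset.sum_add_distrib, Finset.mul_sum,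
        Finset.mul_sum]
      exact Finset.sum_congr rfl fun p _ => by ring
    · ring

/-! ### The functions f as solutions, and the theorem. -/

theorem IsLogNear.eventually_hasDerivAt {L : ℂ → ℂ} {z : ℂ} (hz : z ≠ 0) (hL : IsLogNear L z) :
    ∀ᶠ w in nhds z, HasDerivAt L w⁻¹ w := by
  obtain ⟨ha, he, -⟩ := hL
  filter_upwards [ha.eventually_analyticAt, he.eventually_nhds, isOpen_ne.mem_nhds hz]
    with w h1 h2 hw
  have hw : w ≠ 0 := hw
  have hd := h1.differentiableAt.hasDerivAt
  have h3 : HasDerivAt (fun w => w) (Complex.exp (L w) * deriv L w) w :=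
    hd.cexp.congr_of_eventuallyEq (Filter.EventuallyEq.symm h2)
  have h4 := h3.unique (hasDerivAt_id' w)
  rw [h2.self_of_nhds] at h4
  rwa [eq_inv_of_mul_eq_one_right h4] at hd

theorem f2_eq_logSum (l : ℕ) {z : ℂ} (hz : 1 < ‖z‖) (L : ℂ) (ν : ℕ) :
    f2 l z ν = logSum 0 (fun s => ratR s ν ^ (2 + l)) L z := by
  simp [f2, logSum, serR_eq_jetSum (l := l) (by lia : 0 < 2 + l) z hz]

theorem f3_eq_logSum (L : ℂ → ℂ) (l : ℕ) {z : ℂ} (hz : 1 < ‖z‖) (ν : ℕ) :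
    f3 L l z ν = -logSum 1 (fun s => ratR s ν ^ (2 + l)) (L z) z := by
  simp only [f3, f2, f4, logSum, Finset.sum_range_succ, Finset.sum_range_zero,
    serR_eq_jetSum (l := l) (by lia : 0 < 2 + l) z hz,
    serR_eq_jetSum (l := l) (by lia : 1 < 2 + l) z hz]
  simp
  ring

theorem f5_eq_logSum (L : ℂ → ℂ) {l : ℕ} (hl : 1 ≤ l) {z : ℂ} (hz : 1 < ‖z‖) (ν : ℕ) :
    f5 L l z ν = 2⁻¹ * logSum 2 (fun s => ratR s ν ^ (2 + l)) (L z) z := by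
  simp only [f5, f2, f4, f6, logSum, Finset.sum_range_succ, Finset.sum_range_zero,
    serR_eq_jetSum (l := l) (by lia : 0 < 2 + l) z hz,
    serR_eq_jetSum (l := l) (by lia : 1 < 2 + l) z hz,
    serR_eq_jetSum (l := l) (by lia : 2 < 2 + l) z hz]
  simp
  ring

theorem f7_eq_logSum (L : ℂ → ℂ) {l : ℕ} (hl : 2 ≤ l) {z : ℂ} (hz : 1 < ‖z‖) (ν : ℕ) :
    f7 L l z ν = -6⁻¹ * logSum 3 (fun s => ratR s ν ^ (2 + l)) (L z) z := by
  simp only [f7, f3, f5, f2, f4, f6, f8, logSum, Finset.sum_range_succ, Finset.sum_range_zero,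
    serR_eq_jetSum (l := l) (by lia : 0 < 2 + l) z hz,
    serR_eq_jetSum (l := l) (by lia : 1 < 2 + l) z hz,
    serR_eq_jetSum (l := l) (by lia : 2 < 2 + l) z hz,
    serR_eq_jetSum (l := l) (by lia : 3 < 2 + l) z hz]
  simp [Nat.choose]
  ring

theorem exists_isSolution_fCheck {l : Fin 3} {k : ℕ} (hk : k ∈ setK l) {z : ℂ} (hz : 1 < ‖z‖)
    {L : ℂ → ℂ} (hL : IsLogNear L z) :
    ∃ Φ, IsSolution l z Φ ∧ ∀ ν, ∀ᶠ w in nhds z, fCheck L l k w ν = Φ ν 0 w := by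
  have hz0 : z ≠ 0 := norm_pos_iff.1 (by linarith)
  have hL' := hL.eventually_hasDerivAt hz0
  have hev : ∀ᶠ w in nhds z, 1 < ‖w‖ :=
    (isOpen_lt continuous_const continuous_norm).mem_nhds hz
  have s1 := (isSolution_logSum l (j := 1) (by lia) hz hL').const_mul (-1)
  -- Membership in 𝔎_l ensures that the order j of differentiation stays below 2 + l. The checked
  -- functions are then constant linear combinations of solutions.
  have hcases : k = 1 ∨ k = 2 ∨ k = 3 ∨ (k = 5 ∧ 1 ≤ (l : ℕ)) ∨ (k = 7 ∧ 2 ≤ (l : ℕ)) := by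
    fin_cases l <;> simp [setK] at hk <;> simp <;> lia
  rcases hcases with rfl | rfl | rfl | ⟨rfl, hl⟩ | ⟨rfl, hl⟩
  · exact ⟨_, isSolution_residueSum l hz0,
      fun ν => Filter.Eventually.of_forall fun w => f1_eq_residueSum l w ν⟩
  · refine ⟨_, isSolution_logSum l (j := 0) (by lia) hz hL', fun ν => ?_⟩
    filter_upwards [hev] with w hw
    simpa [fCheck] using f2_eq_logSum l hw (L w) ν
  · refine ⟨_, s1, fun ν => ?_⟩
    filter_upwards [hev] with w hw
    simpa [fCheck] using f3_eq_logSum L l hw ν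
  · refine ⟨_, (s1.const_mul (-Complex.I * π)).add
      ((isSolution_logSum l (j := 2) (by lia) hz hL').const_mul 2⁻¹), fun ν => ?_⟩
    filter_upwards [hev] with w hw
    simp [fCheck, f3_eq_logSum L l hw ν, f5_eq_logSum L hl hw ν]
  · refine ⟨_, ((isSolution_logSum l (j := 3) (by lia) hz hL').const_mul (-6⁻¹)).add
      (s1.const_mul (2 * π ^ 2 / 3)), fun ν => ?_⟩
    filter_upwards [hev] with w hw
    simp [fCheck, f3_eq_logSum L l hw ν, f7_eq_logSum L hl hw ν]

theorem matA_mulVec_colY {l : Fin 3} {k : ℕ} {z : ℂ} {ν : ℕ} {L : ℂ → ℂ}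
    (hk : k ∈ setK l) (hz : 1 < ‖z‖) (hν : 2 ≤ ν) (hL : IsLogNear L z) :
    (matA l z (ν : ℂ)).mulVec (colY L l k z ν) =
      (matT (4 + 2 * (l : ℕ)) (1 - (ν : ℂ)⁻¹)).mulVec (colY L l k z (ν - 1)) := by
  obtain ⟨Φ, hΦ, hf⟩ := exists_isSolution_fCheck hk hz hL
  exact hΦ.mulVec_eq (f := fun ν w => fCheck L l k w ν)
    (norm_pos_iff.1 (by linarith)) hf hν

theorem matT_neg_one_mul_self {A : Type*} [CommRing A] (n : ℕ) :
    matT n (-1 : A) * matT n (-1 : A) = 1 := by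
  rw [matT_mul_matT]
  simp [matT_one]

theorem theorem1 :
    (∀ (l : Fin 3) (k : ℕ) (z : ℂ) (ν : ℕ) (L : ℂ → ℂ),
      k ∈ setK l → 1 < ‖z‖ → 2 ≤ ν → IsLogNear L z →
        (matA l z (ν : ℂ)).mulVec (colY L l k z ν) =
            (matT (4 + 2 * (l : ℕ)) (1 - (ν : ℂ)⁻¹)).mulVec (colY L l k z (ν - 1)) ∧
        colY L l k z ν =
            (matT (4 + 2 * (l : ℕ)) (-1 : ℂ) * matA l z (-(ν : ℂ)) *
              matT (4 + 2 * (l : ℕ)) (-1 + (ν : ℂ)⁻¹)).mulVec (colY L l k z (ν - 1))) ∧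
    (∀ (l : Fin 3) (z ν : ℂ), ν ≠ 0 →
        matA l z (-ν) * matT (4 + 2 * (l : ℕ)) (-1 : ℂ) * matA l z ν =
          matT (4 + 2 * (l : ℕ)) (-1 : ℂ)) ∧
    (∀ l : Fin 3,
        IsUnit (matS l * matT (4 + 2 * (l : ℕ)) (-1 : ℤ)) ∧
        matS l * matT (4 + 2 * (l : ℕ)) (-1 : ℤ) =
          (matS l * matT (4 + 2 * (l : ℕ)) (-1 : ℤ))⁻¹) ∧
    (∀ (l : Fin 3) (i : ℕ), i ≤ 1 + (l : ℕ) →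
        matS l * matT (4 + 2 * (l : ℕ)) (-1 : ℤ) * matV l i =
          (-(-1 : ℤ) ^ i) • (matV l i * matT (4 + 2 * (l : ℕ)) (-1 : ℤ) * matS l)) ∧
    (∀ (l : Fin 3) (i k : ℕ), i ≤ 1 + (l : ℕ) → k ≤ 1 + (l : ℕ) →
        matV l i * matT (4 + 2 * (l : ℕ)) (-1 : ℤ) * matV l k = 0) := by
  refine ⟨fun l k z ν L hk hz hν hL => ?_, fun l z ν _ => matA_mul_matT_mul_matA l z ν, fun l => ?_,
    matS_mul_matT_mul_matV, matV_mul_matT_mul_matV⟩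
  · have h := matA_mulVec_colY hk hz hν hL
    refine ⟨h, ?_⟩
    have hT : matT (4 + 2 * (l : ℕ)) (-1 + (ν : ℂ)⁻¹) =
        matT (4 + 2 * (l : ℕ)) (-1 : ℂ) * matT (4 + 2 * (l : ℕ)) (1 - (ν : ℂ)⁻¹) := by
      rw [matT_mul_matT]
      congr 1
      ring
    -- By part (b), T A(-ν) T A(ν) = T T = 1, so T A(-ν) T undoes A(ν) in the first recursion.
    rw [hT, ← mul_assoc, ← Matrix.mulVec_mulVec, ← h, Matrix.mulVec_mulVec, mul_assoc, mul_assoc,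
      ← mul_assoc (matA l z (-(ν : ℂ))), matA_mul_matT_mul_matA, matT_neg_one_mul_self,
      Matrix.one_mulVec]
  · have h : matS l * matT (4 + 2 * (l : ℕ)) (-1 : ℤ) *
        (matS l * matT (4 + 2 * (l : ℕ)) (-1 : ℤ)) = 1 := by
      rw [← mul_assoc, matS_mul_matT_mul_matS, matT_neg_one_mul_self]
    exact ⟨IsUnit.of_mul_eq_one _ h, (Matrix.inv_eq_left_inv h).symm⟩
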